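/- Let $\lambda>0$, $\epsilon>0$ and $L>0$. Let $0<X_1<X_2<\cdots$ be the points of a homogeneous Poisson process of intensity $\lambda$ on $[0,\infty)$, that is, $X_1, X_2-X_1, X_3-X_2,\dots$ are independent and exponentially distributed with parameter $\lambda$. Two consecutive points $X_l, X_{l+1}$ are directly connected if $X_{l+1}-X_l\le\epsilon$; the points $X_i$ and $X_j$ with $i\le j$ are connected if $X_l$ and $X_{l+1}$ are directly connected for every $l=i,\dots,j-1$. A cluster is a class of mutually connected points; it begins at its first point and ends at distance $\epsilon$ after its last point. Let $\beta_0(L)$ be the number of complete clusters in $[0,L]$, i.e. of the clusters whose beginning and end both lie in $[0,L]$. Then, for every integer $n\ge 0$, $$\Pr(\beta_0(L)=n)=\frac{1}{n!}\sum_{i=0}^{\lfloor L/\epsilon\rfloor-n}\frac{(-1)^i}{i!}\Bigl(\bigl(L-(n+i)\epsilon\bigr)\,\lambda e^{-\lambda\epsilon}\Bigr)^{n+i},$$ where the sum is empty, hence $0$, if $n>\lfloor L/\epsilon\rfloor$. -/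

import Mathlib

open MeasureTheory ProbabilityTheory

/-- The gaps of a sequence of positions, the first one being measured from the origin:
`X 0, X 1 - X 0, X 2 - X 1, …`. -/
def gap {Ω : Type*} (X : ℕ → Ω → ℝ) : ℕ → Ω → ℝ
  | 0 => X 0
  | i + 1 => fun ω => X (i + 1) ω - X i ω

/-- `X 0, X 1, X 2, …` are the successive points of a (homogeneous) Poisson process on the
half-line `[0, ∞)` with intensity `rate`: the gaps are independent, and each of them is
exponentially distributed with parameter `rate`. -/
structure IsPoissonProcess {Ω : Type*} [MeasurableSpace Ω] (X : ℕ → Ω → ℝ) (rate : ℝ)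
    (P : Measure Ω) : Prop where
  measurable : ∀ i, Measurable (X i)
  indep : iIndepFun (gap X) P
  law : ∀ i, HasLaw (gap X i) (expMeasure rate) P

/-- Sensors located at `x` and `y` are directly connected when their distance is at most `ε`. -/
def DirectlyConnected (ε x y : ℝ) : Prop := |x - y| ≤ ε

/-- For sensors at the positions `x 0, x 1, …` (listed from left to right), the sensors `i` and `j`
are connected, directly or indirectly, when any two consecutive sensors between
them are directly connected. Every sensor is connected to itself. -/
def SensorsConnected (ε : ℝ) (x : ℕ → ℝ) (i j : ℕ) : Prop :=
  ∀ l, min i j ≤ l → l < max i j → DirectlyConnected ε (x l) (x (l + 1))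

/-- Being connected is an equivalence relation on the sensors. -/
def clusterSetoid (ε : ℝ) (x : ℕ → ℝ) : Setoid ℕ where
  r := SensorsConnected ε x
  iseqv :=
    { refl := fun i l h₁ h₂ => absurd h₂ (by simp at h₁ ⊢; exact h₁)
      symm := fun {i j} h l h₁ h₂ => h l (by rwa [min_comm]) (by rwa [max_comm])
      trans := fun {i j k} hij hjk l h₁ h₂ => by
        by_cases h : min i j ≤ l ∧ l < max i j
        · exact hij l h.1 h.2
        · exact hjk l (by omega) (by omega) }

/-- The clusters: the classes of mutually connected sensors. -/
def clusters (ε : ℝ) (x : ℕ → ℝ) : Set (Set ℕ) := (clusterSetoid ε x).classes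

/-- A cluster begins at its first sensor and ends at distance `ε` after its last sensor. It is
complete in `[0, L]` when it lies in `[0, L]` from its beginning to its end, that is, when
`[x j, x j + ε] ⊆ [0, L]` for each of its sensors `j`. -/
def IsCompleteCluster (ε L : ℝ) (x : ℕ → ℝ) (C : Set ℕ) : Prop :=
  ∀ j ∈ C, 0 ≤ x j ∧ x j + ε ≤ L

/-- The number of complete clusters in `[0, L]`. -/
noncomputable def numCompleteClusters (ε L : ℝ) (x : ℕ → ℝ) : ℕ∞ :=
  {C ∈ clusters ε x | IsCompleteCluster ε L x C}.encard

open scoped ENNReal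

/-! Let `N` be the number of complete clusters. The proof computes its binomial moments and inverts
them. A complete cluster corresponds to its last point: a point at most `L - ε` followed by a gap
larger than `ε` (`numCompleteClusters_pos`). So `N.choose k` counts `k`-subsets of `endSet`, and
choosing the least element first gives the recursion `numClusterSets`. On average, the points form
the measure `rate * dy`, each independent of the gaps after it (`tsum_lintegral_pos_dropSeq`). By
lack of memory, requiring the next gap to exceed `ε` costs a factor `exp (-(rate * ε))` and shortens
the window by `ε`. Iterating, the mean of `N.choose k` is `((L - k ε)₊ * rate * exp (-(rate * ε))) ^
k / k!` (`lintegral_numClusterSets`). Since `N ≤ ⌊L / ε⌋₊` almost surely, a finite alternating sum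
of these moments recovers the law of `N`. -/

/-! ### Gap sequences and their product law. -/

/-- Prepend a term to a sequence. -/
def consSeq (a : ℝ) (g : ℕ → ℝ) : ℕ → ℝ
  | 0 => a
  | i + 1 => g i

/-- The positions of the points with given successive gaps. -/
def pos (g : ℕ → ℝ) (j : ℕ) : ℝ := ∑ i ∈ Finset.range (j + 1), g i

/-- The sequence without its first `j` terms. -/
def dropSeq (j : ℕ) (g : ℕ → ℝ) : ℕ → ℝ := fun i => g (j + i)

@[fun_prop]
lemma measurable_pos (j : ℕ) : Measurable fun g => pos g j := by
  unfold pos; fun_prop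

@[fun_prop]
lemma measurable_dropSeq (j : ℕ) : Measurable (dropSeq j) := by
  unfold dropSeq; fun_prop

@[fun_prop]
lemma measurable_consSeq : Measurable fun p : ℝ × (ℕ → ℝ) => consSeq p.1 p.2 := by
  refine measurable_pi_lambda _ fun i => ?_
  cases i with
  | zero => exact measurable_fst
  | succ i => exact (measurable_pi_apply i).comp measurable_snd

lemma pos_consSeq_zero (a : ℝ) (g : ℕ → ℝ) : pos (consSeq a g) 0 = a := by
  simp [pos, consSeq]

lemma pos_consSeq_succ (a : ℝ) (g : ℕ → ℝ) (j : ℕ) :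
    pos (consSeq a g) (j + 1) = a + pos g j := by
  rw [pos, Finset.sum_range_succ', add_comm]
  rfl

lemma pos_consSeq_add (a b : ℝ) (g : ℕ → ℝ) (j : ℕ) :
    pos (consSeq (a + b) g) j = a + pos (consSeq b g) j := by
  cases j with
  | zero => simp only [pos_consSeq_zero]
  | succ j => rw [pos_consSeq_succ, pos_consSeq_succ, add_assoc]

lemma dropSeq_consSeq_succ (a : ℝ) (g : ℕ → ℝ) (j : ℕ) :
    dropSeq (j + 1) (consSeq a g) = dropSeq j g := by
  funext i
  rw [dropSeq, Nat.succ_add_eq_add_succ]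
  rfl

lemma dropSeq_zero (g : ℕ → ℝ) : dropSeq 0 g = g := by
  funext i; simp [dropSeq]

/-- Boxes over finite index sets determine the product measure. Filling up with `Set.univ` makes the
index set an initial segment, from which coordinate `0` splits off. -/
lemma map_consSeq_prod_infinitePi (ν : Measure ℝ) [IsProbabilityMeasure ν] :
    (ν.prod (Measure.infinitePi fun _ : ℕ => ν)).map (fun p => consSeq p.1 p.2) =
      Measure.infinitePi fun _ : ℕ => ν := by
  classical
  refine Measure.eq_infinitePi _ fun s t ht => ?_
  obtain ⟨N, hN⟩ : ∃ N, s ⊆ Finset.range (N + 1) :=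
    ⟨s.sup id, fun i hi => Finset.mem_range_succ_iff.2 (Finset.le_sup (f := id) hi)⟩
  set t' : ℕ → Set ℝ := fun i => if i ∈ s then t i else Set.univ with ht'
  have hm : ∀ i, MeasurableSet (t' i) := fun i => by
    simp only [ht']; split_ifs
    exacts [ht i, .univ]
  have h1 : (s : Set ℕ).pi t = (Finset.range (N + 1) : Set ℕ).pi t' := by
    ext g
    simp only [Set.mem_pi, Finset.mem_coe, ht']
    constructor
    · intro h i _
      split_ifs with hi
      exacts [h i hi, trivial]
    · intro h i hi
      have := h i (hN hi)
      rwa [if_pos hi] at this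
  have h2 : ∏ i ∈ s, ν (t i) = ∏ i ∈ Finset.range (N + 1), ν (t' i) := by
    rw [← Finset.prod_subset hN]
    · exact Finset.prod_congr rfl fun i hi => by simp [ht', hi]
    · intro i _ hi
      simp [ht', hi]
  have h3 : (fun p : ℝ × (ℕ → ℝ) => consSeq p.1 p.2) ⁻¹'
      (Finset.range (N + 1) : Set ℕ).pi t' =
      t' 0 ×ˢ (Finset.range N : Set ℕ).pi fun i => t' (i + 1) := by
    ext ⟨a, g⟩
    simp only [Set.mem_preimage, Set.mem_pi, Finset.mem_coe, Finset.mem_range, Set.mem_prod]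
    constructor
    · exact fun h => ⟨h 0 (by omega), fun i hi => h (i + 1) (by omega)⟩
    · rintro ⟨h0, h⟩ i hi
      cases i with
      | zero => exact h0
      | succ i => exact h i (by omega)
  rw [h1, h2, Measure.map_apply measurable_consSeq
    (.pi (Finset.countable_toSet _) fun i _ => hm i), h3, Measure.prod_prod,
    Measure.infinitePi_pi _ (fun i _ => hm (i + 1)), Finset.prod_range_succ', mul_comm]

lemma lintegral_infinitePi_eq_consSeq (ν : Measure ℝ) [IsProbabilityMeasure ν]
    {F : (ℕ → ℝ) → ℝ≥0∞} (hF : Measurable F) :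
    ∫⁻ g, F g ∂(Measure.infinitePi fun _ : ℕ => ν) =
      ∫⁻ a, ∫⁻ g, F (consSeq a g) ∂(Measure.infinitePi fun _ : ℕ => ν) ∂ν := by
  conv_lhs => rw [← map_consSeq_prod_infinitePi ν]
  rw [lintegral_map hF measurable_consSeq, lintegral_prod _ (by fun_prop)]

/-! ### Laws of the points and the intensity of the process. -/

/-- The density of the `j`-th point of a Poisson process. -/
noncomputable def pointDensity (r : ℝ) (j : ℕ) (y : ℝ) : ℝ≥0∞ :=
  ENNReal.ofReal (r * ((r * y) ^ j / j.factorial) * Real.exp (-(r * y)))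

@[fun_prop]
lemma measurable_pointDensity (r : ℝ) (j : ℕ) : Measurable (pointDensity r j) := by
  unfold pointDensity; fun_prop

lemma lintegral_expMeasure (r : ℝ) {f : ℝ → ℝ≥0∞} (hf : Measurable f) :
    ∫⁻ a, f a ∂(expMeasure r) = ∫⁻ a in Set.Ioi 0, pointDensity r 0 a * f a := by
  have : expMeasure r = volume.withDensity
      fun x => ENNReal.ofReal (exponentialPDFReal r x) := rfl
  rw [this, lintegral_withDensity_eq_lintegral_mul _
    (measurable_exponentialPDFReal r).ennreal_ofReal hf, ← lintegral_indicator measurableSet_Ioi]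
  change ∫⁻ x, exponentialPDF r x * f x = _
  -- The exponential density is positive at `0`, which the open half-line leaves out.
  have h0 : ∀ᵐ x : ℝ, x ≠ 0 := by simp [ae_iff]
  refine lintegral_congr_ae ?_
  filter_upwards [h0] with x hx
  rcases lt_or_gt_of_ne hx with h | h
  · simp [exponentialPDF_of_neg h, h.le]
  · simp [exponentialPDF_of_nonneg h.le, h, pointDensity]

lemma lintegral_pow_Ioo (z : ℝ) (hz : 0 ≤ z) (j : ℕ) :
    ∫⁻ y in Set.Ioo 0 z, ENNReal.ofReal (y ^ j) = ENNReal.ofReal (z ^ (j + 1) / (j + 1)) := by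
  rw [← ofReal_integral_eq_lintegral_ofReal]
  · rw [← integral_Ioc_eq_integral_Ioo, ← intervalIntegral.integral_of_le hz, integral_pow]
    simp
  · exact ((continuous_pow j).integrableOn_Icc (a := 0) (b := z)).mono_set Set.Ioo_subset_Icc_self
  · filter_upwards [ae_restrict_mem measurableSet_Ioo] with y hy
    exact pow_nonneg hy.1.le _

/-- Convolution of an exponential with a Gamma law: after substituting `z = a + y` the exponentials
combine to `exp (-(r * z))`, leaving the integral of `y ^ j` over `(0, z)`. -/
lemma lintegral_pointDensity_add (r : ℝ) (hr : 0 < r) (j : ℕ) {f : ℝ → ℝ≥0∞} (hf : Measurable f) :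
    ∫⁻ a in Set.Ioi 0, pointDensity r 0 a *
        ∫⁻ y in Set.Ioi 0, pointDensity r j y * f (a + y) =
      ∫⁻ z in Set.Ioi 0, pointDensity r (j + 1) z * f z := by
  have h1 : ∫⁻ a in Set.Ioi 0, pointDensity r 0 a *
        ∫⁻ y in Set.Ioi 0, pointDensity r j y * f (a + y) =
      ∫⁻ y in Set.Ioi 0, ∫⁻ a in Set.Ioi 0, pointDensity r 0 a * (pointDensity r j y * f (a + y)) := by
    rw [lintegral_lintegral_swap (by fun_prop)]
    exact lintegral_congr fun a => (lintegral_const_mul _ (by fun_prop)).symm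
  have h2 : ∀ y : ℝ, ∫⁻ a in Set.Ioi 0, pointDensity r 0 a * (pointDensity r j y * f (a + y)) =
      ∫⁻ z, (Set.Ioi y).indicator (fun z => pointDensity r 0 (z - y) * (pointDensity r j y * f z)) z := by
    intro y
    rw [← lintegral_indicator measurableSet_Ioi, ← lintegral_sub_right_eq_self _ y]
    refine lintegral_congr fun z => ?_
    simp [Set.indicator_apply]
  rw [h1, ← lintegral_indicator measurableSet_Ioi, ← lintegral_indicator measurableSet_Ioi]
  have h3 : ∀ y : ℝ, (Set.Ioi (0:ℝ)).indicator (fun y => ∫⁻ a in Set.Ioi 0,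
      pointDensity r 0 a * (pointDensity r j y * f (a + y))) y =
      ∫⁻ z, {p : ℝ × ℝ | 0 < p.1 ∧ p.1 < p.2}.indicator
        (fun p => pointDensity r 0 (p.2 - p.1) * (pointDensity r j p.1 * f p.2)) (y, z) := by
    intro y
    by_cases hy : 0 < y
    · rw [Set.indicator_of_mem (Set.mem_Ioi.2 hy), h2]
      refine lintegral_congr fun z => ?_
      simp [Set.indicator_apply, hy]
    · simp [hy]
  rw [lintegral_congr h3, lintegral_lintegral_swap]
  swap
  · refine Measurable.aemeasurable ?_
    refine Measurable.indicator (by fun_prop) ?_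
    exact (measurableSet_lt measurable_const measurable_fst).inter
      (measurableSet_lt measurable_fst measurable_snd)
  refine lintegral_congr fun z => ?_
  by_cases hz : 0 < z
  · rw [Set.indicator_of_mem (Set.mem_Ioi.2 hz)]
    have h4 : ∀ y, {p : ℝ × ℝ | 0 < p.1 ∧ p.1 < p.2}.indicator
        (fun p => pointDensity r 0 (p.2 - p.1) * (pointDensity r j p.1 * f p.2)) (y, z) =
        (Set.Ioo 0 z).indicator (fun y => ENNReal.ofReal
          (r * (r ^ (j + 1) / j.factorial) * Real.exp (-(r * z))) * f z * ENNReal.ofReal (y ^ j)) y := by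
      intro y
      by_cases hy : 0 < y ∧ y < z
      · rw [Set.indicator_of_mem (by exact hy), Set.indicator_of_mem (by exact hy)]
        have h0 : 0 ≤ r * ((r * (z - y)) ^ 0 / (Nat.factorial 0 : ℝ)) *
            Real.exp (-(r * (z - y))) := by simp; positivity
        simp only [pointDensity]
        rw [← mul_assoc, ← ENNReal.ofReal_mul h0, mul_right_comm _ (f z),
          ← ENNReal.ofReal_mul (by positivity)]
        congr 2
        have : Real.exp (-(r * z)) = Real.exp (-(r * (z - y))) * Real.exp (-(r * y)) := by
          rw [← Real.exp_add]; congr 1; ring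
        rw [this]
        simp; ring
      · rw [Set.indicator_of_notMem (by exact hy), Set.indicator_of_notMem (by exact hy)]
    rw [lintegral_congr h4, lintegral_indicator measurableSet_Ioo,
      lintegral_const_mul _ (by fun_prop), lintegral_pow_Ioo z hz.le, mul_right_comm,
      ← ENNReal.ofReal_mul (by positivity), pointDensity]
    congr 2
    rw [Nat.factorial_succ]
    push_cast
    field_simp
    rw [mul_pow]
  · rw [Set.indicator_of_notMem (by simpa using hz), lintegral_eq_zero_of_ae_eq_zero]
    refine Filter.Eventually.of_forall fun y => Set.indicator_of_notMem ?_ _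
    exact fun h => hz (h.1.trans h.2)

/-- The Poisson weights of parameter `r * y` sum to `1`. -/
lemma tsum_pointDensity (r : ℝ) (hr : 0 < r) {y : ℝ} (hy : 0 < y) :
    ∑' j, pointDensity r j y = ENNReal.ofReal r := by
  have h := (NormedSpace.expSeries_div_hasSum_exp (r * y)).mul_left r |>.mul_right (Real.exp (-(r * y)))
  unfold pointDensity
  rw [← ENNReal.ofReal_tsum_of_nonneg (fun j => by positivity) h.summable, h.tsum_eq, mul_assoc,
    ← Real.exp_eq_exp_ℝ,
    ← Real.exp_add]
  simp

/-- The `j`-th point is independent of the subsequent gaps, which are distributed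
as the sequence of all the gaps. -/
lemma lintegral_pos_dropSeq (r : ℝ) (hr : 0 < r) (j : ℕ) {F : ℝ × (ℕ → ℝ) → ℝ≥0∞}
    (hF : Measurable F) :
    ∫⁻ g, F (pos g j, dropSeq (j + 1) g) ∂(Measure.infinitePi fun _ : ℕ => expMeasure r) =
      ∫⁻ y in Set.Ioi 0, pointDensity r j y *
        ∫⁻ g, F (y, g) ∂(Measure.infinitePi fun _ : ℕ => expMeasure r) := by
  have := isProbabilityMeasure_expMeasure hr
  induction j generalizing F with
  | zero =>
    rw [lintegral_infinitePi_eq_consSeq _ (by fun_prop)]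
    simp only [pos_consSeq_zero, dropSeq_consSeq_succ, dropSeq_zero]
    exact lintegral_expMeasure r (by fun_prop)
  | succ j ih =>
    rw [lintegral_infinitePi_eq_consSeq _ (by fun_prop)]
    simp only [pos_consSeq_succ, dropSeq_consSeq_succ]
    have h : ∀ a : ℝ, _ := fun a => ih (F := fun p => F (a + p.1, p.2)) (by fun_prop)
    simp only [h]
    rw [lintegral_expMeasure r (by fun_prop), lintegral_pointDensity_add r hr j
      (f := fun y => ∫⁻ g, F (y, g) ∂(Measure.infinitePi fun _ : ℕ => expMeasure r)) (by fun_prop)]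

/-- A Campbell–Mecke formula: the densities of all points add up to the constant `r`. -/
lemma tsum_lintegral_pos_dropSeq (r : ℝ) (hr : 0 < r) {F : ℝ × (ℕ → ℝ) → ℝ≥0∞}
    (hF : Measurable F) :
    ∑' j, ∫⁻ g, F (pos g j, dropSeq (j + 1) g) ∂(Measure.infinitePi fun _ : ℕ => expMeasure r) =
      ENNReal.ofReal r * ∫⁻ y in Set.Ioi 0,
        ∫⁻ g, F (y, g) ∂(Measure.infinitePi fun _ : ℕ => expMeasure r) := by
  have := isProbabilityMeasure_expMeasure hr
  simp only [lintegral_pos_dropSeq r hr _ hF]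
  rw [← lintegral_tsum (fun j => by fun_prop), ← lintegral_const_mul _ (by fun_prop)]
  refine setLIntegral_congr_fun measurableSet_Ioi fun y hy => ?_
  simp only [ENNReal.tsum_mul_right, tsum_pointDensity r hr hy]

/-! ### Lack of memory and almost sure properties. -/

/-- Lack of memory of the exponential distribution. -/
lemma lintegral_expMeasure_memoryless (r ε : ℝ) (hε : 0 ≤ ε) {f : ℝ → ℝ≥0∞}
    (hf : Measurable f) :
    ∫⁻ a, (Set.Ioi ε).indicator f a ∂(expMeasure r) =
      ENNReal.ofReal (Real.exp (-(r * ε))) * ∫⁻ b, f (ε + b) ∂(expMeasure r) := by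
  rw [lintegral_expMeasure r (hf.indicator measurableSet_Ioi),
    lintegral_expMeasure r (by fun_prop), ← lintegral_const_mul _ (by fun_prop),
    ← lintegral_indicator measurableSet_Ioi, ← lintegral_indicator measurableSet_Ioi,
    ← lintegral_add_left_eq_self _ ε]
  refine lintegral_congr fun b => ?_
  by_cases hb : 0 < b
  · have hb' : 0 < ε + b := by linarith
    simp only [Set.indicator_apply, Set.mem_Ioi, hb, hb', lt_add_iff_pos_right, if_true,
      pointDensity]
    rw [← mul_assoc, ← ENNReal.ofReal_mul (by positivity)]
    congr 2
    have : Real.exp (-(r * (ε + b))) = Real.exp (-(r * ε)) * Real.exp (-(r * b)) := by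
      rw [← Real.exp_add]; congr 1; ring
    rw [this]
    simp; ring
  · simp [Set.indicator_apply, hb]

lemma ae_infinitePi_expMeasure_pos (r : ℝ) (hr : 0 < r) :
    ∀ᵐ g ∂(Measure.infinitePi fun _ : ℕ => expMeasure r), ∀ i, 0 < g i := by
  have := isProbabilityMeasure_expMeasure hr
  refine ae_all_iff.2 fun i => ?_
  have h : ∀ᵐ a ∂(expMeasure r), 0 < a := by
    rw [ae_iff, ← lintegral_indicator_one (by simp only [not_lt]; exact measurableSet_Iic),
      lintegral_expMeasure r (measurable_one.indicator (by simp only [not_lt]; exact measurableSet_Iic))]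
    rw [setLIntegral_congr_fun (g := 0) measurableSet_Ioi]
    · simp
    · intro x hx
      simp [Set.mem_Ioi.1 hx]
  exact (measurePreserving_eval_infinitePi (fun _ : ℕ => expMeasure r) i).quasiMeasurePreserving.ae h

/-- The mean number of points up to `L` is finite, so almost surely not all points lie there. -/
lemma ae_infinitePi_expMeasure_exists_lt_pos (r : ℝ) (hr : 0 < r) (L : ℝ) :
    ∀ᵐ g ∂(Measure.infinitePi fun _ : ℕ => expMeasure r), ∃ j, L < pos g j := by
  have := isProbabilityMeasure_expMeasure hr
  have hF : Measurable fun p : ℝ × (ℕ → ℝ) => (Set.Iic L).indicator (1 : ℝ → ℝ≥0∞) p.1 :=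
    (measurable_one.indicator measurableSet_Iic).comp measurable_fst
  have h := tsum_lintegral_pos_dropSeq r hr hF
  simp only [lintegral_const, measure_univ, mul_one] at h
  rw [lintegral_indicator_one measurableSet_Iic, Measure.restrict_apply measurableSet_Iic,
    Set.Iic_inter_Ioi, ← lintegral_tsum (fun j => by
      exact (hF.comp ((measurable_pos j).prodMk (measurable_dropSeq (j + 1)))).aemeasurable)] at h
  have h' := ae_lt_top (Measurable.tsum fun j =>
    hF.comp ((measurable_pos j).prodMk (measurable_dropSeq (j + 1))))
    (ne_of_eq_of_ne h (ENNReal.mul_ne_top (by simp) (by simp)))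
  filter_upwards [h'] with g hg
  by_contra! hc
  simp [Set.indicator_apply, hc] at hg

/-! ### Complete clusters and their last points. -/

/-- The indices of the last points of the complete clusters. -/
def endSet (ε L : ℝ) (g : ℕ → ℝ) : Set ℕ := {j | pos g j + ε ≤ L ∧ ε < g (j + 1)}

lemma pos_succ (g : ℕ → ℝ) (j : ℕ) : pos g (j + 1) = pos g j + g (j + 1) :=
  Finset.sum_range_succ _ _

lemma pos_dropSeq (g : ℕ → ℝ) (j i : ℕ) :
    pos (dropSeq (j + 1) g) i = pos g (j + 1 + i) - pos g j := by
  have : pos g (j + 1 + i) = pos g j + pos (dropSeq (j + 1) g) i :=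
    Finset.sum_range_add g (j + 1) (i + 1)
  linarith

lemma strictMono_pos {g : ℕ → ℝ} (hg : ∀ i, 0 < g i) : StrictMono (pos g) :=
  strictMono_nat_of_lt_succ fun j => by rw [pos_succ]; linarith [hg (j + 1)]

lemma pos_pos {g : ℕ → ℝ} (hg : ∀ i, 0 < g i) (j : ℕ) : 0 < pos g j :=
  Finset.sum_pos (fun i _ => hg i) (by simp)

lemma endSet_dropSeq (ε L : ℝ) (g : ℕ → ℝ) (j : ℕ) :
    endSet ε (L - pos g j) (dropSeq (j + 1) g) = {i | j + 1 + i ∈ endSet ε L g} := by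
  ext i
  simp only [endSet, Set.mem_ofPred_eq, pos_dropSeq, dropSeq, ← add_assoc]
  refine and_congr_left fun _ => ?_
  constructor <;> intro h <;> linarith

lemma sensorsConnected_pos_iff {ε : ℝ} {g : ℕ → ℝ} (hg : ∀ i, 0 < g i) {i j : ℕ} :
    SensorsConnected ε (pos g) i j ↔ ∀ l, min i j ≤ l → l < max i j → g (l + 1) ≤ ε := by
  unfold SensorsConnected DirectlyConnected
  have (l : ℕ) : |pos g l - pos g (l + 1)| = g (l + 1) := by
    rw [abs_sub_comm, pos_succ, add_sub_cancel_left, abs_of_pos (hg _)]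
  simp only [this]

/-- A complete cluster is determined by its last point. -/
lemma numCompleteClusters_pos {ε L : ℝ} {g : ℕ → ℝ} (hg : ∀ i, 0 < g i)
    (hL : ∃ j, L < pos g j + ε) :
    numCompleteClusters ε L (pos g) = (endSet ε L g).encard := by
  classical
  have hconn {i j : ℕ} := sensorsConnected_pos_iff (ε := ε) hg (i := i) (j := j)
  have hinj : Set.InjOn (fun j => {i | SensorsConnected ε (pos g) i j}) (endSet ε L g) := by
    intro i hi j hj hij
    have h : SensorsConnected ε (pos g) i j := by
      have : i ∈ {k | SensorsConnected ε (pos g) k j} := by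
        have hij' : {k | SensorsConnected ε (pos g) k i} = {k | SensorsConnected ε (pos g) k j} := hij
        rw [← hij']
        exact (clusterSetoid ε (pos g)).refl i
      exact this
    rw [hconn] at h
    by_contra hne
    rcases lt_or_gt_of_ne hne with hlt | hlt
    · exact absurd (h i (by omega) (by omega)) (not_le.2 hi.2)
    · exact absurd (h j (by omega) (by omega)) (not_le.2 hj.2)
  rw [numCompleteClusters, ← hinj.encard_image]
  congr 1
  ext C
  constructor
  · rintro ⟨⟨i, rfl⟩, hC⟩
    have hC' : ∀ j, SensorsConnected ε (pos g) j i → pos g j + ε ≤ L := fun j hj => (hC j hj).2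
    -- Otherwise the cluster of `i` would contain every later point, including one beyond `L - ε`.
    -- The least such `l` is the last point of the cluster.
    have hex : ∃ l, i ≤ l ∧ ε < g (l + 1) := by
      by_contra! hno
      obtain ⟨j, hj⟩ := hL
      have h1 : pos g j ≤ pos g (max i j) := (strictMono_pos hg).monotone (le_max_right _ _)
      have h2 := hC' (max i j) (hconn.2 fun l hl _ => hno l (by omega))
      linarith
    obtain ⟨hle, hgap⟩ := Nat.find_spec hex
    set m := Nat.find hex with hm
    have hmin : ∀ l, i ≤ l → l < m → g (l + 1) ≤ ε := fun l h1 h2 => by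
      have := Nat.find_min hex h2
      push Not at this
      exact this h1
    have hmi : SensorsConnected ε (pos g) m i :=
      hconn.2 fun l h1 h2 => hmin l (by omega) (by omega)
    refine ⟨m, ⟨hC' m hmi, hgap⟩, ?_⟩
    ext k
    exact ⟨fun h => (clusterSetoid ε (pos g)).trans h hmi,
      fun h => (clusterSetoid ε (pos g)).trans h ((clusterSetoid ε (pos g)).symm hmi)⟩
  · rintro ⟨j, hj, rfl⟩
    refine ⟨⟨j, rfl⟩, fun i hi => ⟨(pos_pos hg i).le, ?_⟩⟩
    have hij : i ≤ j := by
      by_contra! hlt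
      exact absurd (hconn.1 hi j (by omega) (by omega)) (not_le.2 hj.2)
    linarith [(strictMono_pos hg).monotone hij, hj.1]

lemma finite_endSet {ε L : ℝ} {g : ℕ → ℝ} (hg : ∀ i, 0 < g i) (hL : ∃ j, L < pos g j + ε) :
    (endSet ε L g).Finite := by
  obtain ⟨m, hm⟩ := hL
  refine (Set.finite_lt_nat m).subset fun j hj => ?_
  by_contra hlt
  linarith [(strictMono_pos hg).monotone (not_lt.1 hlt), hj.1]

/-- Each end except the greatest, `m`, is followed by a gap above `ε` lying before `pos g m`, and
`m` itself leaves room `ε` below `L`. -/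
lemma card_le_floor_of_eq_endSet {ε L : ℝ} (hε : 0 < ε) {g : ℕ → ℝ} (hg : ∀ i, 0 < g i)
    {S : Finset ℕ} (hS : (S : Set ℕ) = endSet ε L g) : S.card ≤ ⌊L / ε⌋₊ := by
  classical
  rcases S.eq_empty_or_nonempty with rfl | hne
  · simp
  have hmem : ∀ j ∈ S, pos g j + ε ≤ L ∧ ε < g (j + 1) := fun j hj => by
    have : j ∈ endSet ε L g := hS ▸ hj
    exact this
  set m := S.max' hne
  have hm : m ∈ S := S.max'_mem hne
  have h1 : ((S.erase m).card : ℝ) * ε ≤ ∑ j ∈ S.erase m, g (j + 1) := by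
    rw [← nsmul_eq_mul]
    exact Finset.card_nsmul_le_sum _ _ _ fun j hj => (hmem j (Finset.mem_of_mem_erase hj)).2.le
  have h2 : ∑ j ∈ S.erase m, g (j + 1) ≤ pos g m := by
    rw [← Finset.sum_image (f := g) (g := fun j => j + 1) (by simp)]
    refine Finset.sum_le_sum_of_subset_of_nonneg (fun i hi => ?_) fun i _ _ => (hg i).le
    obtain ⟨j, hj, rfl⟩ := Finset.mem_image.1 hi
    have := S.lt_max'_of_mem_erase_max' hne hj
    exact Finset.mem_range.2 (by omega)
  have h3 : (S.card : ℝ) = (S.erase m).card + 1 := by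
    exact_mod_cast (Finset.card_erase_add_one hm).symm
  refine Nat.le_floor ((le_div_iff₀ hε).2 ?_)
  rw [h3]
  linarith [(hmem m hm).1]

/-! ### Counting sets of `k` complete clusters. -/

/-- Sort the subsets of size `k + 1` by their least element `j`. -/
lemma Finset.card_choose_succ_eq_sum_filter_lt {α : Type*} [LinearOrder α] (S : Finset α) (k : ℕ) :
    S.card.choose (k + 1) = ∑ j ∈ S, (S.filter (j < ·)).card.choose k := by
  induction S using Finset.induction_on_min with
  | empty => simp
  | insert a s ha ih =>
    have hnot : a ∉ s := fun h => lt_irrefl _ (ha a h)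
    rw [Finset.sum_insert hnot, Finset.card_insert_of_notMem hnot, Nat.choose_succ_succ, ih]
    congr 1
    · rw [Finset.filter_insert, if_neg (lt_irrefl a), Finset.filter_true_of_mem ha]
    · refine Finset.sum_congr rfl fun j hj => ?_
      rw [Finset.filter_insert, if_neg (ha j hj).not_gt]

/-- The number of sets of `k` complete clusters, as a sum over the last point of the first
cluster of such a set. -/
noncomputable def numClusterSets (ε : ℝ) : ℕ → ℝ → (ℕ → ℝ) → ℝ≥0∞
  | 0, _, _ => 1
  | k + 1, L, g => ∑' j, (endSet ε L g).indicator
      (fun j => numClusterSets ε k (L - pos g j) (dropSeq (j + 1) g)) j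

lemma numClusterSets_eq_choose (ε : ℝ) (k : ℕ) {L : ℝ} {g : ℕ → ℝ} {S : Finset ℕ}
    (hS : (S : Set ℕ) = endSet ε L g) : numClusterSets ε k L g = S.card.choose k := by
  induction k generalizing L g S with
  | zero => simp [numClusterSets]
  | succ k ih =>
    rw [numClusterSets, ← hS, Finset.card_choose_succ_eq_sum_filter_lt, Nat.cast_sum,
      tsum_eq_sum (s := S) fun j hj => Set.indicator_of_notMem (by simpa using hj) _]
    refine Finset.sum_congr rfl fun j hj => ?_
    have hinj : Function.Injective fun i => j + 1 + i := add_right_injective _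
    rw [Set.indicator_of_mem (Finset.mem_coe.2 hj),
      ih (S := S.preimage (fun i => j + 1 + i) hinj.injOn)]
    · congr 2
      rw [← Finset.card_image_of_injective _ hinj]
      congr 1
      ext i
      simp only [Finset.mem_image, Finset.mem_preimage, Finset.mem_filter]
      constructor
      · rintro ⟨i, hi, rfl⟩
        exact ⟨hi, by omega⟩
      · rintro ⟨hi, hji⟩
        exact ⟨i - (j + 1), by rwa [Nat.add_sub_cancel' hji], Nat.add_sub_cancel' hji⟩
    · rw [endSet_dropSeq, ← hS, Finset.coe_preimage]
      rfl

/-- Joint measurability is needed because the recursion replaces `L` by the random `L - pos g j`. -/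
lemma measurable_numClusterSets (ε : ℝ) (k : ℕ) :
    Measurable fun p : ℝ × (ℕ → ℝ) => numClusterSets ε k p.1 p.2 := by
  induction k with
  | zero => exact measurable_const
  | succ k ih =>
    refine Measurable.tsum fun j => ?_
    have hm : MeasurableSet {p : ℝ × (ℕ → ℝ) | pos p.2 j + ε ≤ p.1 ∧ ε < p.2 (j + 1)} :=
      MeasurableSet.inter (s₁ := {p : ℝ × (ℕ → ℝ) | pos p.2 j + ε ≤ p.1})
        (s₂ := {p : ℝ × (ℕ → ℝ) | ε < p.2 (j + 1)})
        (measurableSet_le (by fun_prop) (by fun_prop))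
        (measurableSet_lt (by fun_prop) (by fun_prop))
    exact Measurable.indicator (f := fun p : ℝ × (ℕ → ℝ) =>
      numClusterSets ε k (p.1 - pos p.2 j) (dropSeq (j + 1) p.2))
      (ih.comp (f := fun p : ℝ × (ℕ → ℝ) => (p.1 - pos p.2 j, dropSeq (j + 1) p.2))
        (by fun_prop)) hm

/-- `endSet` never compares the first gap with `ε`, so that gap acts only by translating all points.
-/
lemma numClusterSets_consSeq_add (ε : ℝ) (k : ℕ) (L a b : ℝ) (g : ℕ → ℝ) :
    numClusterSets ε k L (consSeq (a + b) g) = numClusterSets ε k (L - a) (consSeq b g) := by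
  cases k with
  | zero => rfl
  | succ k =>
    have hset : endSet ε L (consSeq (a + b) g) = endSet ε (L - a) (consSeq b g) := by
      ext j
      simp only [endSet, Set.mem_ofPred_eq, pos_consSeq_add, consSeq]
      refine and_congr_left fun _ => ?_
      constructor <;> intro h <;> linarith
    simp only [numClusterSets, hset, pos_consSeq_add, dropSeq_consSeq_succ, sub_sub]

/-! ### Binomial moments of the number of complete clusters. -/

lemma lintegral_numClusterSets_memoryless (r ε : ℝ) (hr : 0 < r) (hε : 0 ≤ ε) (k : ℕ) (L : ℝ) :
    ∫⁻ g, {g : ℕ → ℝ | ε < g 0}.indicator (numClusterSets ε k L) g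
        ∂(Measure.infinitePi fun _ : ℕ => expMeasure r) =
      ENNReal.ofReal (Real.exp (-(r * ε))) *
        ∫⁻ g, numClusterSets ε k (L - ε) g ∂(Measure.infinitePi fun _ : ℕ => expMeasure r) := by
  have := isProbabilityMeasure_expMeasure hr
  have hmk := measurable_numClusterSets ε k
  have hm : ∀ L, Measurable (numClusterSets ε k L) := fun L => hmk.comp measurable_prodMk_left
  have hms : MeasurableSet {g : ℕ → ℝ | ε < g 0} :=
    measurableSet_lt measurable_const (measurable_pi_apply 0)
  rw [lintegral_infinitePi_eq_consSeq _ ((hm L).indicator hms),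
    lintegral_infinitePi_eq_consSeq _ (hm (L - ε))]
  have hm2 : Measurable fun p : ℝ × (ℕ → ℝ) => numClusterSets ε k L (consSeq p.1 p.2) :=
    (hm L).comp measurable_consSeq
  rw [← lintegral_congr fun b => lintegral_congr fun g =>
      numClusterSets_consSeq_add ε k L ε b g,
    ← lintegral_expMeasure_memoryless r ε hε
      (f := fun a => ∫⁻ g, numClusterSets ε k L (consSeq a g)
        ∂(Measure.infinitePi fun _ : ℕ => expMeasure r)) hm2.lintegral_prod_right']
  refine lintegral_congr fun a => ?_
  by_cases ha : ε < a
  · rw [Set.indicator_of_mem (Set.mem_Ioi.2 ha)]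
    exact lintegral_congr fun g => Set.indicator_of_mem (by exact ha) _
  · rw [Set.indicator_of_notMem (by simpa using ha)]
    refine (lintegral_congr fun g => Set.indicator_of_notMem (by exact ha) _).trans (by simp)

/-- Here `y` is the last point of the first chosen cluster; the condition on the gap after it is
absorbed by lack of memory. -/
lemma lintegral_numClusterSets_succ (r ε : ℝ) (hr : 0 < r) (hε : 0 ≤ ε) (k : ℕ) (L : ℝ) :
    ∫⁻ g, numClusterSets ε (k + 1) L g ∂(Measure.infinitePi fun _ : ℕ => expMeasure r) =
      ENNReal.ofReal (r * Real.exp (-(r * ε))) * ∫⁻ y in Set.Ioc 0 (L - ε),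
        ∫⁻ g, numClusterSets ε k (L - y - ε) g
          ∂(Measure.infinitePi fun _ : ℕ => expMeasure r) := by
  have := isProbabilityMeasure_expMeasure hr
  have hmk := measurable_numClusterSets ε k
  set F : ℝ × (ℕ → ℝ) → ℝ≥0∞ :=
    {p : ℝ × (ℕ → ℝ) | p.1 + ε ≤ L ∧ ε < p.2 0}.indicator
      fun p => numClusterSets ε k (L - p.1) p.2 with hF_def
  have hF : Measurable F := by
    refine Measurable.indicator (hmk.comp
      (f := fun p : ℝ × (ℕ → ℝ) => (L - p.1, p.2)) (by fun_prop)) ?_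
    exact MeasurableSet.inter (s₁ := {p : ℝ × (ℕ → ℝ) | p.1 + ε ≤ L})
      (s₂ := {p : ℝ × (ℕ → ℝ) | ε < p.2 0})
      (measurableSet_le (by fun_prop) (by fun_prop))
      (measurableSet_lt (by fun_prop) (by fun_prop))
  have h1 : ∀ g, numClusterSets ε (k + 1) L g = ∑' j, F (pos g j, dropSeq (j + 1) g) :=
    fun g => tsum_congr fun j => by
      simp only [hF_def, Set.indicator_apply, endSet, Set.mem_ofPred_eq, dropSeq, add_zero]
  rw [lintegral_congr h1, lintegral_tsum fun j => by fun_prop,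
    tsum_lintegral_pos_dropSeq r hr hF, ENNReal.ofReal_mul hr.le, mul_assoc]
  congr 1
  have hm3 : Measurable fun y : ℝ => ∫⁻ g, numClusterSets ε k (L - y - ε) g
      ∂(Measure.infinitePi fun _ : ℕ => expMeasure r) := by
    have : Measurable fun p : ℝ × (ℕ → ℝ) => numClusterSets ε k (L - p.1 - ε) p.2 :=
      hmk.comp (f := fun p : ℝ × (ℕ → ℝ) => (L - p.1 - ε, p.2)) (by fun_prop)
    exact this.lintegral_prod_right'
  rw [← lintegral_const_mul _ hm3, ← lintegral_indicator measurableSet_Ioi,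
    ← lintegral_indicator measurableSet_Ioc]
  refine lintegral_congr fun y => ?_
  by_cases hy : 0 < y
  · rw [Set.indicator_of_mem (Set.mem_Ioi.2 hy)]
    by_cases hyL : y ≤ L - ε
    · rw [Set.indicator_of_mem (Set.mem_Ioc.2 ⟨hy, hyL⟩),
        ← lintegral_numClusterSets_memoryless r ε hr hε k (L - y)]
      refine lintegral_congr fun g => ?_
      have : y + ε ≤ L := by linarith
      simp [hF_def, Set.indicator_apply, this]
    · rw [Set.indicator_of_notMem fun h => hyL h.2]
      refine (lintegral_congr fun g => Set.indicator_of_notMem ?_ _).trans lintegral_zero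
      exact fun h => hyL (by linarith [h.1])
  · rw [Set.indicator_of_notMem (by simpa using hy), Set.indicator_of_notMem fun h => hy h.1]

/-- Used with `a = L - (k + 1) * ε` and `b = L - ε`. The integrand vanishes beyond `a` except when
`k = 0`, where `0 ^ 0 = 1`; hence `hk`. -/
lemma lintegral_pow_max_sub (a : ℝ) (k : ℕ) {b : ℝ} (hab : a ≤ b) (hk : k = 0 → a = b) :
    ∫⁻ y in Set.Ioc 0 b, ENNReal.ofReal (max (a - y) 0 ^ k) =
      ENNReal.ofReal (max a 0 ^ (k + 1) / (k + 1)) := by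
  have h1 : ∫⁻ y in Set.Ioc 0 b, ENNReal.ofReal (max (a - y) 0 ^ k) =
      ∫⁻ y in Set.Ioo 0 a, ENNReal.ofReal ((a - y) ^ k) := by
    rw [setLIntegral_congr (Ioo_ae_eq_Ioc (a := (0 : ℝ)) (b := a)),
      ← lintegral_indicator measurableSet_Ioc, ← lintegral_indicator measurableSet_Ioc]
    refine lintegral_congr fun y => ?_
    by_cases hy : 0 < y
    · by_cases hya : y ≤ a
      · rw [Set.indicator_of_mem (Set.mem_Ioc.2 ⟨hy, hya.trans hab⟩),
          Set.indicator_of_mem (Set.mem_Ioc.2 ⟨hy, hya⟩), max_eq_left (by linarith)]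
      · rw [Set.indicator_of_notMem (s := Set.Ioc 0 a) fun h => hya h.2]
        rcases Nat.eq_zero_or_pos k with rfl | hk'
        · rw [Set.indicator_of_notMem fun h => hya (hk rfl ▸ h.2)]
        · simp [Set.indicator_apply, (not_le.1 hya).le, hk'.ne']
    · rw [Set.indicator_of_notMem fun h => hy h.1, Set.indicator_of_notMem fun h => hy h.1]
  rw [h1]
  rcases le_total 0 a with ha | ha
  · rw [max_eq_left ha, ← lintegral_pow_Ioo a ha k, ← lintegral_indicator measurableSet_Ioo,
      ← lintegral_indicator measurableSet_Ioo, ← lintegral_sub_left_eq_self _ a]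
    refine lintegral_congr fun y => ?_
    simp only [Set.indicator_apply, Set.mem_Ioo, sub_pos, sub_lt_self_iff, sub_sub_cancel, and_comm]
  · simp [max_eq_right ha, Set.Ioo_eq_empty_of_le ha]

/-- The mean number of sets of `k` complete clusters. -/
lemma lintegral_numClusterSets (r ε : ℝ) (hr : 0 < r) (hε : 0 ≤ ε) (k : ℕ) (L : ℝ) :
    ∫⁻ g, numClusterSets ε k L g ∂(Measure.infinitePi fun _ : ℕ => expMeasure r) =
      ENNReal.ofReal ((max (L - k * ε) 0 * r * Real.exp (-(r * ε))) ^ k / k.factorial) := by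
  have := isProbabilityMeasure_expMeasure hr
  induction k generalizing L with
  | zero => simp [numClusterSets]
  | succ k ih =>
    rw [lintegral_numClusterSets_succ r ε hr hε]
    have h : ∀ y, ∫⁻ g, numClusterSets ε k (L - y - ε) g
        ∂(Measure.infinitePi fun _ : ℕ => expMeasure r) =
        ENNReal.ofReal ((r * Real.exp (-(r * ε))) ^ k / k.factorial) *
          ENNReal.ofReal (max (L - (k + 1) * ε - y) 0 ^ k) := fun y => by
      rw [ih, ← ENNReal.ofReal_mul (by positivity)]
      congr 1
      rw [show L - y - ε - k * ε = L - (k + 1) * ε - y by ring, mul_assoc, mul_pow]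
      ring
    simp only [h]
    rw [lintegral_const_mul _ (by fun_prop), lintegral_pow_max_sub _ k, ← mul_assoc,
      ← ENNReal.ofReal_mul (by positivity), ← ENNReal.ofReal_mul (by positivity)]
    · congr 1
      rw [Nat.factorial_succ]
      push_cast
      field_simp
      ring
    · nlinarith [mul_nonneg (Nat.cast_nonneg (α := ℝ) k) hε]
    · rintro rfl
      simp

/-! ### Inversion and conclusion. -/

/-- Binomial inversion: the indicator of `N = n` in terms of the binomial coefficients of `N`. -/
lemma sum_neg_one_pow_mul_choose_mul_choose {N n M : ℕ} (hM : N < M + n) :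
    ∑ i ∈ Finset.range M, (-1 : ℝ) ^ i * (n + i).choose n * N.choose (n + i) =
      if N = n then 1 else 0 := by
  rcases lt_or_ge N n with hlt | hle
  · rw [if_neg hlt.ne]
    refine Finset.sum_eq_zero fun i _ => ?_
    rw [Nat.choose_eq_zero_of_lt (by omega : N < n + i)]
    simp
  · obtain ⟨m, rfl⟩ := Nat.exists_eq_add_of_le hle
    -- Pulling out `(n + m).choose n` leaves the alternating sum of the `m.choose i`, zero unless `m
    -- = 0`.
    have h : ∀ i, (-1 : ℝ) ^ i * (n + i).choose n * (n + m).choose (n + i) =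
        (n + m).choose n * ((-1 : ℝ) ^ i * m.choose i) := fun i => by
      rcases le_or_gt i m with him | him
      · have := Nat.choose_mul (n := n + m) (k := n + i) (s := n) (by omega)
        simp only [Nat.add_sub_cancel_left] at this
        have h' : ((n + m).choose (n + i) : ℝ) * (n + i).choose n = (n + m).choose n * m.choose i := by
          exact_mod_cast this
        linear_combination (-1 : ℝ) ^ i * h'
      · rw [Nat.choose_eq_zero_of_lt him, Nat.choose_eq_zero_of_lt (by omega : n + m < n + i)]
        simp
    rw [Finset.sum_congr rfl fun i _ => h i, ← Finset.mul_sum]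
    have h2 : ∑ i ∈ Finset.range M, (-1 : ℝ) ^ i * m.choose i =
        ∑ i ∈ Finset.range (m + 1), (-1 : ℝ) ^ i * m.choose i := by
      refine (Finset.sum_subset (Finset.range_mono (by omega)) fun i _ hi => ?_).symm
      rw [Nat.choose_eq_zero_of_lt (by simpa using hi)]
      simp
    have h3 : ∑ i ∈ Finset.range (m + 1), (-1 : ℝ) ^ i * m.choose i = if m = 0 then 1 else 0 := by
      exact_mod_cast Int.alternating_sum_range_choose (n := m)
    rw [h2, h3]
    rcases Nat.eq_zero_or_pos m with rfl | hm
    · simp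
    · simp [hm.ne']

theorem mainTheorem1 {Ω : Type*} [MeasurableSpace Ω] (P : Measure Ω) [IsProbabilityMeasure P]
    (rate ε L : ℝ) (hrate : 0 < rate) (hε : 0 < ε) (hL : 0 < L)
    (X : ℕ → Ω → ℝ) (hX : IsPoissonProcess X rate P) (n : ℕ) :
    P.real {ω | numCompleteClusters ε L (fun i => X i ω) = (n : ℕ∞)} =
      1 / (n.factorial : ℝ) *
        ∑ i ∈ Finset.range (⌊L / ε⌋₊ + 1 - n),
          (-1 : ℝ) ^ i / (i.factorial : ℝ) *
            ((L - ((n : ℝ) + (i : ℝ)) * ε) * rate * Real.exp (-(rate * ε))) ^ (n + i) := by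
  have := isProbabilityMeasure_expMeasure hrate
  set μ := Measure.infinitePi fun _ : ℕ => expMeasure rate with hμ
  have hlaw : HasLaw (fun ω i => gap X i ω) μ P :=
    hX.indep.hasLaw_infinitePi hX.law (aemeasurable_pi_lambda _ fun i => (hX.law i).aemeasurable)
  have hposX : ∀ ω, (fun i => X i ω) = pos fun i => gap X i ω := fun ω => by
    funext i
    induction i with
    | zero => simp [pos, gap]
    | succ i ih =>
      rw [pos_succ, ← ih]
      simp [gap]
  have hm : ∀ k, Measurable (numClusterSets ε k L) :=
    fun k => (measurable_numClusterSets ε k).comp measurable_prodMk_left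
  have hae : ∀ᵐ g ∂μ, ∃ S : Finset ℕ, (S : Set ℕ) = endSet ε L g ∧ S.card ≤ ⌊L / ε⌋₊ ∧
      numCompleteClusters ε L (pos g) = S.card := by
    filter_upwards [ae_infinitePi_expMeasure_pos rate hrate,
      ae_infinitePi_expMeasure_exists_lt_pos rate hrate (L - ε)] with g hg hgL
    have hgL' : ∃ j, L < pos g j + ε := hgL.imp fun j hj => by linarith
    have hS := (finite_endSet hg hgL').coe_toFinset
    refine ⟨_, hS, card_le_floor_of_eq_endSet hε hg hS, ?_⟩
    rw [numCompleteClusters_pos hg hgL', ← Set.encard_coe_eq_coe_finsetCard, hS]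
  -- For `k = 1` the sets are single clusters, so the event agrees almost surely with a measurable
  -- one.
  have hone : ∀ᵐ g ∂μ, numCompleteClusters ε L (pos g) = n ↔ numClusterSets ε 1 L g = n := by
    filter_upwards [hae] with g ⟨S, hS, _, hcard⟩
    rw [hcard, numClusterSets_eq_choose ε 1 hS, Nat.choose_one_right]
    norm_cast
  have hset : MeasurableSet {g | numClusterSets ε 1 L g = n} :=
    hm 1 (measurableSet_singleton _)
  have htransfer : P.real {ω | numCompleteClusters ε L (fun i => X i ω) = (n : ℕ∞)} =
      μ.real {g | numClusterSets ε 1 L g = n} := by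
    rw [← hlaw.map_eq, map_measureReal_apply_of_aemeasurable hlaw.aemeasurable hset]
    refine measureReal_congr ?_
    rw [← hlaw.map_eq] at hone
    filter_upwards [ae_of_ae_map hlaw.aemeasurable hone] with ω hω
    refine propext ?_
    change numCompleteClusters ε L (fun i => X i ω) = n ↔ _
    rw [hposX]
    exact hω
  have hint : ∀ k, Integrable (fun g => (numClusterSets ε k L g).toReal) μ := fun k =>
    integrable_toReal_of_lintegral_ne_top (hm k).aemeasurable
      (by rw [lintegral_numClusterSets rate ε hrate hε.le]; exact ENNReal.ofReal_ne_top)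
  -- The inversion holds pathwise; the bound on `S.card` allows one truncation for almost every `g`.
  have hind : {g | numClusterSets ε 1 L g = n}.indicator (1 : (ℕ → ℝ) → ℝ) =ᵐ[μ] fun g =>
      ∑ i ∈ Finset.range (⌊L / ε⌋₊ + 1 - n),
        (-1 : ℝ) ^ i * (n + i).choose n * (numClusterSets ε (n + i) L g).toReal := by
    filter_upwards [hae] with g ⟨S, hS, hle, _⟩
    simp only [numClusterSets_eq_choose ε _ hS, ENNReal.toReal_natCast, Set.indicator_apply,
      Set.mem_ofPred_eq, Nat.choose_one_right, Nat.cast_inj, Pi.one_apply]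
    exact (sum_neg_one_pow_mul_choose_mul_choose (by omega)).symm
  rw [htransfer, ← integral_indicator_one hset, integral_congr_ae hind,
    integral_finsetSum _ fun i _ => (hint _).const_mul _, Finset.mul_sum]
  refine Finset.sum_congr rfl fun i hi => ?_
  -- In the range of summation `L - (n + i) * ε` is nonnegative, so the positive part in the moment
  -- formula disappears.
  have hfloor : n + i ≤ ⌊L / ε⌋₊ := by have := Finset.mem_range.1 hi; omega
  have hnonneg : 0 ≤ L - ((n + i : ℕ) : ℝ) * ε := by
    have := (le_div_iff₀ hε).1 ((Nat.le_floor_iff (by positivity)).1 hfloor)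
    linarith
  rw [integral_const_mul, integral_toReal (hm _).aemeasurable, lintegral_numClusterSets rate ε
    hrate hε.le, ENNReal.toReal_ofReal (by positivity), max_eq_left hnonneg, Nat.cast_add]
  · have h := Nat.add_choose_mul_factorial_mul_factorial n i
    rw [← Nat.choose_symm_add] at h
    have h' : ((n + i).choose n : ℝ) * n.factorial * i.factorial = (n + i).factorial := by
      exact_mod_cast h
    rw [← h']
    have : ((n + i).choose n : ℝ) ≠ 0 := by
      exact_mod_cast (Nat.choose_pos (Nat.le_add_right n i)).ne'
    field_simp
  · filter_upwards [hae] with g ⟨S, hS, _⟩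
    rw [numClusterSets_eq_choose ε _ hS]
    exact ENNReal.natCast_lt_top _
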